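/- **Setting.** Let $n\ge 1$. All congruences are modulo $2$, $[n]=\{1,\dots,n\}$ and $[n-1]_0=\{0,\dots,n-1\}$. Let $B_n$ be the hyperoctahedral group of permutations $w$ of $\{-n,\dots,n\}$ with $w(-x)=-w(x)$, with Coxeter generators $s_0=[-1,2,\dots,n]$ and $s_i=[1,\dots,i-1,i+1,i,i+2,\dots,n]$ for $1\le i\le n-1$, and Coxeter length $\ell$. The descent set of $w$ is $D(w)=\{i\in[n-1]_0 : \ell(ws_i)<\ell(w)\}$. For $J\subseteq[n-1]_0$ put $J^c=[n-1]_0\setminus J$ and $B_n^J=\{w\in B_n: D(w)\subseteq J^c\}$. The signed permutation matrix of $w$ has entry $w_{r,c}=1$ if $w(c)=r$, $w_{r,c}=-1$ if $w(c)=-r$, and $w_{r,c}=0$ otherwise. Let $i(c)$ be the row of the nonzero entry of column $c$ and $j(r)$ the column of the nonzero entry of row $r$. Let $C_n$ be the set of chessboard elements, those $w\in B_n$ with $r+c\equiv 0$ whenever $w_{r,c}\ne0$. Let $C_n^J=C_n\cap B_n^J$, and let $(C_n^J)_k$ be the set of $w\in C_n^J$ with $w(k)=n$ or $w(k+1)=-n$.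 A row $s$ is *between* the rows $a$ and $b$ if $\min(a,b)<s<\max(a,b)$. A row $r$ is *right* of $k$ if $j(r)>k$, and $\varepsilon_r=w_{r,j(r)}\in\{\pm1\}$ is its sign. **Swaps.** Fix a column $k$ and $w$. * A *sign swap* is a singleton $(t)$, where $t\in[n]$ is even, $t\le k$, and every row $s<i(t)$ is right of $k$. * A *two swap* is a pair $(b,t)$ with $1\le b<t\le n$, $b\equiv t$, such that every row between $i(b)$ and $i(t)$ is right of $k$. * A two swap is a *left swap* if $t\le k$. * It is a *double-minus swap* if $k<b$, $\varepsilon_{i(b)}=\varepsilon_{i(t)}=-1$, and all rows between $i(b)$ and $i(t)$ have sign $+1$. * It is a *single-minus swap* if $b\le k<t$, $\varepsilon_{i(t)}=-1$, and all rows between $i(b)$ and $i(t)$ have sign $+1$. * *Double-plus* and *single-plus* swaps are defined in the same way with all signs reversed. A *general-minus $k$-swap* is a sign, left, single-minus, double-minus, single-plus or double-plus swap that is not a single-plus swap. **Blocks and pairs.** Fix $j$. For $1\le r\le s\le n$, the set of rows $\{r,\dots,s\}$ is a *block* $B_{r,s}$ if it is a maximal interval of rows that are right of $j$. It is a *block of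 ones* $P_{r,s}$ (respectively a *block of minus ones* $N_{r,s}$) if it is a maximal interval of rows that are right of $j$ and have sign $+1$ (respectively $-1$). Each of these is called *odd* if $r\equiv s$ and *even* otherwise. For $\varepsilon,\delta\in\{\pm1\}$, the columns $t,t+1$ form an *$(\varepsilon,\delta)_t$ pair* if $j<t<n$, $t\not\equiv n$, $w_{i(t),t}=\varepsilon$ and $w_{i(t+1),t+1}=\delta$. **Initially uncanceled.** An element $w\in(C_n^{I^c})_j$ is *initially uncanceled* (with respect to $j$) if: 1. $j(n-1)<j$ or $w_{n-1,j(n-1)}=-1$. 2. There are no odd blocks. 3. If row $t$ is right of $j$ and has sign $+1$, then $t$ lies in an even block of ones, except possibly if every row above $t$ is right of $j$ and has sign $+1$. 4. If $n$ is even, there is no $(-1,1)_t$ pair. If $n$ is odd, there is at most one $(-1,1)_t$ pair, and if it exists then $i(t+1)=1$ and every row above $i(t)$ is right of $j$ and has sign $+1$. 5. For every $(-1,-1)_t$ pair, every row between $i(t)$ and $i(t+1)$ is right of $j$ and has sign $+1$. 6. If a block of minus ones $N_{p,q}$ is contained in a block $B_{r,s}$ and $N_{p,q}\ne B_{r,s}$,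 then $N_{p,q}$ is odd if and only if $p=r$ or $q=s$. 7. If $B_{r,s}$ is an even block and $P_{r,q}$ (respectively $P_{p,s}$) is an even block of ones, then $q=s$ (respectively $p=r$). **Theorem.** Let $I=\{i_1<\dots<i_l\}\subseteq[n-1]_0$, put $i_{l+1}=n$, and let $j=i_r\in I$ be such that $i_{k+1}-i_k$ is even for all $r\le k\le l$. Then an element $w\in(C_n^{I^c})_j$ is initially uncanceled with respect to $j$ if and only if it has no general-minus $j$-swaps. -/

import Mathlib

namespace SignedPerm

/-! ### The hyperoctahedral group -/

/-- The hyperoctahedral group `B_n`: the permutations `w` of `{-n, …, n}` with `w(-x) = -w(x)`.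
A permutation of `{-n, …, n}` is regarded as a permutation of `ℤ` that fixes every `x` with
`n < |x|`. -/
def hyperoctahedral (n : ℕ) : Subgroup (Equiv.Perm ℤ) where
  carrier := {w | (∀ x : ℤ, w (-x) = -w x) ∧ ∀ x : ℤ, (n : ℤ) < |x| → w x = x}
  one_mem' := by simp
  mul_mem' := by
    rintro v w ⟨hv, hv'⟩ ⟨hw, hw'⟩
    refine ⟨fun x => by simp [hv, hw], fun x hx => ?_⟩
    simp [hw' x hx, hv' x hx]
  inv_mem' := by
    rintro w ⟨hw, hw'⟩
    refine ⟨fun x => ?_, fun x hx => ?_⟩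
    · rw [Equiv.Perm.inv_eq_iff_eq, hw]
      simp
    · rw [Equiv.Perm.inv_eq_iff_eq, hw' x hx]

/-- The Coxeter generators: `s_0 = [-1, 2, …, n]` and, for `i ≥ 1`,
`s_i = [1, …, i-1, i+1, i, i+2, …, n]`. -/
def coxeterGen (i : ℕ) : Equiv.Perm ℤ :=
  if i = 0 then Equiv.swap 1 (-1)
  else Equiv.swap (i : ℤ) (i + 1) * Equiv.swap (-(i : ℤ)) (-(i + 1))

/-- The Coxeter length of `w ∈ B_n` with respect to `s_0, …, s_{n-1}`. -/
noncomputable def coxeterLength (n : ℕ) (w : Equiv.Perm ℤ) : ℕ :=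
  sInf {m | ∃ l : List ℕ, (∀ i ∈ l, i < n) ∧ l.length = m ∧ (l.map coxeterGen).prod = w}

/-- The right descent set `D(w) = {i ∈ {0, …, n-1} | ℓ(w s_i) < ℓ(w)}`. -/
def descentSet (n : ℕ) (w : Equiv.Perm ℤ) : Set ℕ :=
  {i | i < n ∧ coxeterLength n (w * coxeterGen i) < coxeterLength n w}

/-- The complement `J^c = {0, …, n-1} \ J`. -/
def compl (n : ℕ) (J : Finset ℕ) : Finset ℕ := Finset.range n \ J

/-- The quotient `B_n^J = {w ∈ B_n | D(w) ⊆ J^c}`. -/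
def quotient (n : ℕ) (J : Finset ℕ) : Set (Equiv.Perm ℤ) :=
  {w | w ∈ hyperoctahedral n ∧ descentSet n w ⊆ compl n J}

/-! ### The signed permutation matrix -/

/-- The entry `w_{r,c}` of the signed permutation matrix of `w`; rows and columns are numbered
`1, …, n`. -/
def entry (w : Equiv.Perm ℤ) (r c : ℕ) : ℤ :=
  if w c = r then 1 else if w c = -(r : ℤ) then -1 else 0

/-- `i_w(c)`: the row of the nonzero entry of column `c`. -/
def rowOf (w : Equiv.Perm ℤ) (c : ℕ) : ℕ := (w c).natAbs

/-- `j_w(r)`: the column of the nonzero entry of row `r`. -/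
def colOf (w : Equiv.Perm ℤ) (r : ℕ) : ℕ := (w⁻¹ r).natAbs

theorem entry_ne_zero_iff_rowOf (w : Equiv.Perm ℤ) (r c : ℕ) :
    entry w r c ≠ 0 ↔ rowOf w c = r := by
  unfold entry rowOf
  split_ifs <;> simp <;> omega

theorem entry_ne_zero_iff_colOf {n : ℕ} {w : Equiv.Perm ℤ} (hw : w ∈ hyperoctahedral n)
    (r c : ℕ) : entry w r c ≠ 0 ↔ colOf w r = c := by
  have h1 : w⁻¹ (r : ℤ) = c ↔ w c = r := by
    rw [Equiv.Perm.inv_eq_iff_eq]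
    exact eq_comm
  have h2 : w⁻¹ (r : ℤ) = -(c : ℤ) ↔ w c = -(r : ℤ) := by
    rw [Equiv.Perm.inv_eq_iff_eq, hw.1]
    constructor <;> intro h <;> omega
  rw [entry_ne_zero_iff_rowOf, colOf, rowOf, Int.natAbs_eq_iff, Int.natAbs_eq_iff, h1, h2]

/-- The chessboard elements `C_n`. -/
def chessboard (n : ℕ) : Set (Equiv.Perm ℤ) :=
  {w | w ∈ hyperoctahedral n ∧ ∀ r c : ℕ, 1 ≤ r → r ≤ n → 1 ≤ c → c ≤ n →
    entry w r c ≠ 0 → r + c ≡ 0 [MOD 2]}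

/-- `C_n^J = C_n ∩ B_n^J`. -/
def chessboardQuotient (n : ℕ) (J : Finset ℕ) : Set (Equiv.Perm ℤ) :=
  chessboard n ∩ quotient n J

/-- `(C_n^J)_k`: the elements `w` of `C_n^J` with `w(k) = n` or `w(k+1) = -n`. -/
def chessboardQuotientAt (n : ℕ) (J : Finset ℕ) (k : ℕ) : Set (Equiv.Perm ℤ) :=
  {w | w ∈ chessboardQuotient n J ∧ (w k = n ∨ w (k + 1) = -(n : ℤ))}

/-- If `I = {i_1 < ⋯ < i_l}`, `i_{l+1} = n` and `j = i_r`, then `i_{k+1} - i_k` is even for all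
`k` with `r ≤ k ≤ l`. -/
def LaterGapsEven (n : ℕ) (I : Finset ℕ) (j : ℕ) : Prop :=
  ∀ a ∈ I, ∀ b ∈ insert n I, j ≤ a → a < b → (∀ c ∈ insert n I, ¬(a < c ∧ c < b)) → Even (b - a)

/-! ### Swaps -/

/-- A formal swap: a singleton `(t)` or a pair `(b, t)` of columns. -/
inductive Swap where
  | single (t : ℕ)
  | pair (b t : ℕ)

/-- Row `s` lies strictly between the rows `i_w(b)` and `i_w(t)`. -/
def RowBetween (w : Equiv.Perm ℤ) (b t s : ℕ) : Prop :=
  min (rowOf w b) (rowOf w t) < s ∧ s < max (rowOf w b) (rowOf w t)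

/-- `(t)` is a sign swap for `w` with respect to the column `k`. -/
def IsSignSwap (n k : ℕ) (w : Equiv.Perm ℤ) (t : ℕ) : Prop :=
  1 ≤ t ∧ t ≤ n ∧ t ≡ 0 [MOD 2] ∧ t ≤ k ∧ ∀ s, 1 ≤ s → s < rowOf w t → k < colOf w s

/-- `(b, t)` is a two swap for `w` with respect to the column `k`. -/
def IsTwoSwap (n k : ℕ) (w : Equiv.Perm ℤ) (b t : ℕ) : Prop :=
  1 ≤ b ∧ b < t ∧ t ≤ n ∧ b ≡ t [MOD 2] ∧ ∀ s, RowBetween w b t s → k < colOf w s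

def IsLeftSwap (n k : ℕ) (w : Equiv.Perm ℤ) (b t : ℕ) : Prop :=
  IsTwoSwap n k w b t ∧ t ≤ k

/-- For `ε = -1` a double-minus swap, for `ε = 1` a double-plus swap. -/
def IsDoubleSwap (ε : ℤ) (n k : ℕ) (w : Equiv.Perm ℤ) (b t : ℕ) : Prop :=
  IsTwoSwap n k w b t ∧ entry w (rowOf w b) b = ε ∧ entry w (rowOf w t) t = ε ∧ k < b ∧ b < t ∧
    ∀ s, RowBetween w b t s → entry w s (colOf w s) = -ε

/-- For `ε = -1` a single-minus swap, for `ε = 1` a single-plus swap. -/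
def IsSingleSwap (ε : ℤ) (n k : ℕ) (w : Equiv.Perm ℤ) (b t : ℕ) : Prop :=
  IsTwoSwap n k w b t ∧ entry w (rowOf w t) t = ε ∧ b ≤ k ∧ k < t ∧
    ∀ s, RowBetween w b t s → entry w s (colOf w s) = -ε

def signSwaps (n k : ℕ) (w : Equiv.Perm ℤ) : Set Swap :=
  {x | ∃ t, x = Swap.single t ∧ IsSignSwap n k w t}

def leftSwaps (n k : ℕ) (w : Equiv.Perm ℤ) : Set Swap :=
  {x | ∃ b t, x = Swap.pair b t ∧ IsLeftSwap n k w b t}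

def doubleMinusSwaps (n k : ℕ) (w : Equiv.Perm ℤ) : Set Swap :=
  {x | ∃ b t, x = Swap.pair b t ∧ IsDoubleSwap (-1) n k w b t}

def singleMinusSwaps (n k : ℕ) (w : Equiv.Perm ℤ) : Set Swap :=
  {x | ∃ b t, x = Swap.pair b t ∧ IsSingleSwap (-1) n k w b t}

def doublePlusSwaps (n k : ℕ) (w : Equiv.Perm ℤ) : Set Swap :=
  {x | ∃ b t, x = Swap.pair b t ∧ IsDoubleSwap 1 n k w b t}

def singlePlusSwaps (n k : ℕ) (w : Equiv.Perm ℤ) : Set Swap :=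
  {x | ∃ b t, x = Swap.pair b t ∧ IsSingleSwap 1 n k w b t}

/-- `Swap^k(w)`: all swaps for `w` with respect to the column `k`. -/
def swaps (n k : ℕ) (w : Equiv.Perm ℤ) : Set Swap :=
  signSwaps n k w ∪ leftSwaps n k w ∪ singleMinusSwaps n k w ∪ doubleMinusSwaps n k w ∪
    singlePlusSwaps n k w ∪ doublePlusSwaps n k w

/-- `Swap^k_m(w)`: the general-minus `k`-swaps for `w`. -/
def generalMinusSwaps (n k : ℕ) (w : Equiv.Perm ℤ) : Set Swap :=
  swaps n k w \ singlePlusSwaps n k w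

/-! ### Blocks and pairs -/

/-- The rows `r, …, s` (`1 ≤ r ≤ s ≤ n`) all satisfy `p`, and form a maximal interval of rows
with this property. -/
def IsMaximalRun (n : ℕ) (p : ℕ → Prop) (r s : ℕ) : Prop :=
  1 ≤ r ∧ r ≤ s ∧ s ≤ n ∧ (∀ t, r ≤ t → t ≤ s → p t) ∧
    (s ≠ n → ¬ p (s + 1)) ∧ (r ≠ 1 → ¬ p (r - 1))

/-- `{r, …, s}` is a block `B^k_{r,s}`: its rows have their nonzero entry right of column `k`. -/
def IsBlock (n k : ℕ) (w : Equiv.Perm ℤ) (r s : ℕ) : Prop :=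
  IsMaximalRun n (fun t => k < colOf w t) r s

/-- `{r, …, s}` is a block of ones `P^k_{r,s}` (for `ε = 1`) or a block of minus ones `N^k_{r,s}`
(for `ε = -1`). -/
def IsSignBlock (ε : ℤ) (n k : ℕ) (w : Equiv.Perm ℤ) (r s : ℕ) : Prop :=
  IsMaximalRun n (fun t => k < colOf w t ∧ entry w t (colOf w t) = ε) r s

/-- The interval of rows `{r, …, s}` has an odd number of elements; it is even otherwise. -/
def OddRows (r s : ℕ) : Prop := r ≡ s [MOD 2]

/-- The columns `t, t + 1` form an `(ε, δ)_t` pair with respect to `k`. -/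
def IsPair (n k : ℕ) (w : Equiv.Perm ℤ) (ε δ : ℤ) (t : ℕ) : Prop :=
  t + 1 ≤ n ∧ entry w (rowOf w t) t = ε ∧ entry w (rowOf w (t + 1)) (t + 1) = δ ∧
    ¬ t ≡ n [MOD 2] ∧ k < t

/-- The seven properties that define an initially uncanceled element `w` (with respect to `j`). -/
structure InitiallyUncanceled (n j : ℕ) (w : Equiv.Perm ℤ) : Prop where
  property1 : colOf w (n - 1) < j ∨ entry w (n - 1) (colOf w (n - 1)) = -1
  property2 : ∀ r s, IsBlock n j w r s → ¬ OddRows r s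
  property3 : ∀ t, 1 ≤ t → t ≤ n → entry w t (colOf w t) = 1 → j < colOf w t →
    (∃ r s, IsSignBlock 1 n j w r s ∧ ¬ OddRows r s ∧ r ≤ t ∧ t ≤ s) ∨
      ∀ k, 1 ≤ k → k < t → j < colOf w k ∧ entry w k (colOf w k) = 1
  property4 : (Even n → ∀ t, ¬ IsPair n j w (-1) 1 t) ∧
    (Odd n → (∀ t t', IsPair n j w (-1) 1 t → IsPair n j w (-1) 1 t' → t = t') ∧
      ∀ t, IsPair n j w (-1) 1 t → rowOf w (t + 1) = 1 ∧
        ∀ s, 1 ≤ s → s < rowOf w t → entry w s (colOf w s) = 1 ∧ j < colOf w s)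
  property5 : ∀ t, IsPair n j w (-1) (-1) t → ∀ r, RowBetween w t (t + 1) r →
    entry w r (colOf w r) = 1 ∧ j < colOf w r
  property6 : ∀ p q r s, IsSignBlock (-1) n j w p q → IsBlock n j w r s →
    r ≤ p → q ≤ s → (p, q) ≠ (r, s) → (OddRows p q ↔ p = r ∨ q = s)
  property7 : ∀ r s, IsBlock n j w r s → ¬ OddRows r s →
    (∀ q, IsSignBlock 1 n j w r q → ¬ OddRows r q → q = s) ∧
      ∀ p, IsSignBlock 1 n j w p s → ¬ OddRows p s → p = r

end SignedPerm

namespace SignedPerm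

/-! ### Descents of signed permutations -/

/-! The even gaps force every element of `I` that is at least `j` to have the parity of `n`. By the
chessboard condition row `n` then lies in column `j` with sign `+1`, and the columns right of `j`
split into couples `t, t + 1` with `t ≢ n`. Since `t ∉ I` is not a descent, `w t < w (t + 1)`. This
is all that is kept, as `IsPaired`; it rests on the fact that an inversion in adjacent columns is a
descent (`mem_descentSet_of_lt`), proved by deleting a letter from a shortest word.

Increase within a couple says: a positive right row `r ≢ n` has a positive partner above it, and a
negative right row `r ≡ n` has a negative partner above it. Absence of sign, left, single-minus and
double-minus swaps is a parity condition on the gaps between consecutive rows that are not right, or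
not both right and positive. `SwapFreePattern` records these two kinds of facts, and downward
induction from row `n` yields a rigid picture. Positive right rows form dominoes `r, r + 1` with `r
≢ n`, apart possibly from row `1` (`partner_pos_eq`, `pos_succ`, `pos_pred`). Only positive right
rows separate a negative right row `r ≡ n` from its partner, and the first non-right row above any
negative right row is `≡ n` (`neg_aux`). The seven properties are read off from this.

Conversely, property 2 excludes sign and left swaps, property 3 the minus swaps, and property 6 the
double-plus swaps. The forward direction never uses the absence of double-plus swaps, so that
absence follows from the rest. -/

theorem coxeterGen_zero_apply (x : ℤ) :
    coxeterGen 0 x = if x = 1 then -1 else if x = -1 then 1 else x := by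
  simp [coxeterGen, Equiv.swap_apply_def]

theorem coxeterGen_apply {i : ℕ} (hi : i ≠ 0) (x : ℤ) :
    coxeterGen i x = if x = i then (i : ℤ) + 1 else if x = i + 1 then (i : ℤ)
      else if x = -i then -((i : ℤ) + 1) else if x = -(i + 1) then -(i : ℤ) else x := by
  simp only [coxeterGen, if_neg hi, Equiv.Perm.mul_apply, Equiv.swap_apply_def]
  split_ifs <;> omega

theorem coxeterGen_mul_self (i : ℕ) : coxeterGen i * coxeterGen i = 1 := by
  ext x
  rcases eq_or_ne i 0 with rfl | hi
  · simp only [Equiv.Perm.mul_apply, coxeterGen_zero_apply, Equiv.Perm.one_apply]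
    split_ifs <;> first | omega | simp_all
  · simp only [Equiv.Perm.mul_apply, coxeterGen_apply hi, Equiv.Perm.one_apply]
    split_ifs <;> omega

theorem coxeterGen_mem {n i : ℕ} (hi : i < n) : coxeterGen i ∈ hyperoctahedral n := by
  rcases eq_or_ne i 0 with rfl | h0
  · refine ⟨fun x => ?_, fun x hx => ?_⟩
    · simp only [coxeterGen_zero_apply]
      split_ifs <;> omega
    · rw [lt_abs] at hx
      simp only [coxeterGen_zero_apply]
      split_ifs <;> omega
  · refine ⟨fun x => ?_, fun x hx => ?_⟩
    · simp only [coxeterGen_apply h0]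
      split_ifs <;> omega
    · rw [lt_abs] at hx
      simp only [coxeterGen_apply h0]
      split_ifs <;> omega

theorem word_mem {n : ℕ} (l : List ℕ) (hl : ∀ i ∈ l, i < n) :
    (l.map coxeterGen).prod ∈ hyperoctahedral n := by
  refine Subgroup.list_prod_mem _ fun x hx => ?_
  obtain ⟨i, hi, rfl⟩ := List.mem_map.1 hx
  exact coxeterGen_mem (hl i hi)

/-- If `s_i` reverses the order of `u t < u (t + 1)`, then `u s_t = s_i u`. -/
theorem mul_coxeterGen_eq_of_reverses {n t i : ℕ} {u : Equiv.Perm ℤ}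
    (hu : u ∈ hyperoctahedral n) (ht : t ≠ 0) (h : u t < u (t + 1))
    (h' : coxeterGen i (u (t + 1)) < coxeterGen i (u t)) :
    u * coxeterGen t = coxeterGen i * u := by
  have h1 : u (-(t : ℤ)) = -u t := hu.1 _
  have h2 : u (-((t : ℤ) + 1)) = -u (t + 1) := hu.1 _
  have h3 : u t ≠ -u (t + 1) := by
    rw [← h2]
    intro h
    have := u.injective h
    omega
  have hz : u 0 = 0 := by
    have := hu.1 0
    simp only [neg_zero] at this
    omega
  have h5 : u t ≠ 0 := by
    intro h
    have := u.injective (h.trans hz.symm)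
    omega
  have h6 : u (t + 1) ≠ 0 := by
    intro h
    have := u.injective (h.trans hz.symm)
    omega
  -- `s_i` reverses the order of very few pairs of integers. Those involving `0`, and the pair `-1,
  -- 1` reversed by `s_0`, are excluded because `u t` and `u (t + 1)` are nonzero and not opposite.
  have key : i ≠ 0 ∧ ((u t = i ∧ u (t + 1) = i + 1) ∨ (u t = -(i + 1) ∧ u (t + 1) = -i)) := by
    rcases eq_or_ne i 0 with rfl | hi
    · simp only [coxeterGen_zero_apply] at h'
      split_ifs at h' <;> omega
    · refine ⟨hi, ?_⟩
      simp only [coxeterGen_apply hi] at h'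
      split_ifs at h' <;> omega
  obtain ⟨hi, key⟩ := key
  have h4 : u * coxeterGen t =
      Equiv.swap (u t) (u (t + 1)) * Equiv.swap (-u t) (-u (t + 1)) * u := by
    rw [coxeterGen, if_neg ht, ← mul_assoc, Equiv.mul_swap_eq_swap_mul u, mul_assoc,
      Equiv.mul_swap_eq_swap_mul u, h1, h2, mul_assoc]
  rw [h4]
  congr 1
  ext x
  rw [coxeterGen_apply hi]
  simp only [Equiv.Perm.mul_apply, Equiv.swap_apply_def]
  rcases key with ⟨ha, hb⟩ | ⟨ha, hb⟩ <;> rw [ha, hb] <;> split_ifs <;> omega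

/-- The exchange property at an inversion in adjacent columns. -/
theorem exists_shorter_word {n t : ℕ} (ht : t ≠ 0) (l : List ℕ) (hl : ∀ i ∈ l, i < n)
    (h : (l.map coxeterGen).prod (t + 1) < (l.map coxeterGen).prod t) :
    ∃ l' : List ℕ, (∀ i ∈ l', i < n) ∧ l'.length + 1 = l.length ∧
      (l'.map coxeterGen).prod = (l.map coxeterGen).prod * coxeterGen t := by
  induction l with
  | nil => simp at h
  | cons i l ih =>
    have hl' : ∀ i ∈ l, i < n := fun x hx => hl x (List.mem_cons_of_mem _ hx)
    rcases lt_trichotomy ((l.map coxeterGen).prod (t + 1)) ((l.map coxeterGen).prod t)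
      with h1 | h1 | h1
    · obtain ⟨l', h2, h3, h4⟩ := ih hl' h1
      refine ⟨i :: l', ?_, by simp [h3], ?_⟩
      · intro x hx
        rcases List.mem_cons.1 hx with rfl | hx
        · exact hl _ (by simp)
        · exact h2 x hx
      · simp [h4, mul_assoc]
    · have := Equiv.injective _ h1
      omega
    -- The letter `i` creates the inversion, so it is the one to delete: with `v` the product of
    -- `l`, `s_i v s_t = s_i s_i v = v`.
    · refine ⟨l, hl', by simp, ?_⟩
      have h2 := mul_coxeterGen_eq_of_reverses (i := i) (word_mem l hl') ht h1 (by simpa using h)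
      rw [List.map_cons, List.prod_cons, mul_assoc, h2, ← mul_assoc, coxeterGen_mul_self, one_mul]

/-! ### ### Generation by the Coxeter generators; inversions are descents -/

theorem abs_apply_le {n : ℕ} {w : Equiv.Perm ℤ} (hw : w ∈ hyperoctahedral n) {x : ℤ}
    (hx : |x| ≤ n) : |w x| ≤ n := by
  by_contra! h
  have := w.injective (hw.2 _ h)
  rw [this] at h
  omega

/-- Climbing from column `0` gives `c ≤ w c`; descending from `w n ≤ n` gives `w c ≤ c`. -/
theorem eq_one_of_increasing {n : ℕ} {w : Equiv.Perm ℤ} (hw : w ∈ hyperoctahedral n)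
    (h0 : 1 ≤ n → 0 < w 1) (h : ∀ t : ℕ, 1 ≤ t → t < n → w t < w (t + 1)) : w = 1 := by
  have hz : w 0 = 0 := by
    have := hw.1 0
    simp only [neg_zero] at this
    omega
  have h1 : ∀ c : ℕ, c ≤ n → (c : ℤ) ≤ w c := by
    intro c
    induction c with
    | zero => intro _; simp [hz]
    | succ c ih =>
      intro hc
      rcases Nat.eq_zero_or_pos c with rfl | hc'
      · have := h0 hc
        simp only [zero_add, Nat.cast_one]
        omega
      · have h2 := h c hc' hc
        have h3 := ih (by omega)
        push_cast
        omega
  have h2 : ∀ d c : ℕ, c + d = n → w c ≤ c := by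
    intro d
    induction d with
    | zero =>
      intro c hc
      have h3 := abs_apply_le hw (x := c) (by rw [abs_le]; omega)
      rw [abs_le] at h3
      omega
    | succ d ih =>
      intro c hc
      have h3 := ih (c + 1) (by omega)
      push_cast at h3
      rcases Nat.eq_zero_or_pos c with rfl | hc'
      · simp [hz]
      · have := h c hc' (by omega)
        omega
  have h3 : ∀ c : ℕ, w c = c := by
    intro c
    by_cases hc : c ≤ n
    · exact le_antisymm (h2 (n - c) c (by omega)) (h1 c hc)
    · exact hw.2 _ (by rw [lt_abs]; omega)
  ext x
  rcases Int.natAbs_eq x with hx | hx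
  · rw [hx, h3]; rfl
  · rw [hx, hw.1, h3]; rfl

/-- A weight that strictly increases when an inversion in adjacent columns is removed. -/
def weight (n : ℕ) (w : Equiv.Perm ℤ) : ℤ := ∑ c ∈ Finset.range (n + 1), (c : ℤ) * w c

theorem weight_le {n : ℕ} {w : Equiv.Perm ℤ} (hw : w ∈ hyperoctahedral n) :
    weight n w ≤ (n + 1) * (n * n) := by
  have : weight n w ≤ ∑ c ∈ Finset.range (n + 1), (n : ℤ) * n := by
    refine Finset.sum_le_sum fun c hc => ?_
    rw [Finset.mem_range] at hc
    have h1 := abs_apply_le hw (x := c) (by rw [abs_le]; omega)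
    rw [abs_le] at h1
    have h2 : (c : ℤ) ≤ n := by omega
    nlinarith
  simpa using this

theorem weight_lt_mul_zero {n : ℕ} {w : Equiv.Perm ℤ} (hw : w ∈ hyperoctahedral n) (hn : 1 ≤ n)
    (h : w 1 < 0) : weight n w < weight n (w * coxeterGen 0) := by
  refine Finset.sum_lt_sum (fun c _ => ?_) ⟨1, by simp; omega, ?_⟩
  · rw [Equiv.Perm.mul_apply, coxeterGen_zero_apply]
    split_ifs with h1 h2
    · have := hw.1 1
      rw [h1, this]
      nlinarith
    · exact absurd h2 (by simp)
    · exact le_rfl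
  · rw [Equiv.Perm.mul_apply, coxeterGen_zero_apply]
    have := hw.1 1
    simp [this]
    omega

theorem weight_lt_mul {n t : ℕ} {w : Equiv.Perm ℤ} (ht : 1 ≤ t) (htn : t < n)
    (h : w (t + 1) < w t) : weight n w < weight n (w * coxeterGen t) := by
  have key : ∀ v : Equiv.Perm ℤ, weight n v = t * v t + (t + 1) * v (t + 1) +
      ∑ c ∈ (Finset.range (n + 1)).erase t |>.erase (t + 1), (c : ℤ) * v c := by
    intro v
    rw [weight, ← Finset.add_sum_erase _ _ (show t ∈ Finset.range (n + 1) by simp; omega),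
      ← Finset.add_sum_erase _ _
        (show t + 1 ∈ (Finset.range (n + 1)).erase t by simp; omega), add_assoc]
    push_cast
    rfl
  rw [key, key]
  have h1 : ∀ x, (w * coxeterGen t) x = w (coxeterGen t x) := fun _ => rfl
  have ht0 : t ≠ 0 := by omega
  have h2 : coxeterGen t t = t + 1 := by rw [coxeterGen_apply ht0]; simp
  have h3 : coxeterGen t (t + 1) = t := by rw [coxeterGen_apply ht0]; simp
  have h4 : ∑ c ∈ (Finset.range (n + 1)).erase t |>.erase (t + 1),
      (c : ℤ) * (w * coxeterGen t) c =
      ∑ c ∈ (Finset.range (n + 1)).erase t |>.erase (t + 1), (c : ℤ) * w c := by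
    refine Finset.sum_congr rfl fun c hc => ?_
    simp only [Finset.mem_erase] at hc
    rw [h1, coxeterGen_apply ht0]
    congr 2
    split_ifs <;> omega
  rw [h4, h1, h1, h2, h3]
  -- The right side exceeds the left by `w t - w (t + 1)`.
  nlinarith

/-- The elements `s_0, …, s_{n-1}` generate `B_n`. -/
theorem exists_word {n : ℕ} {w : Equiv.Perm ℤ} (hw : w ∈ hyperoctahedral n) :
    ∃ l : List ℕ, (∀ i ∈ l, i < n) ∧ (l.map coxeterGen).prod = w := by
  -- Induction on the distance from the weight to its upper bound `weight_le`: sorting the entries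
  -- raises the weight.
  induction hm : ((n + 1) * (n * n) - weight n w : ℤ).toNat using Nat.strong_induction_on
    generalizing w with
  | _ m ih =>
    have step : ∀ i < n, weight n w < weight n (w * coxeterGen i) →
        ∃ l : List ℕ, (∀ i ∈ l, i < n) ∧ (l.map coxeterGen).prod = w := by
      intro i hi hlt
      have h1 := mul_mem hw (coxeterGen_mem hi)
      have h2 := weight_le h1
      obtain ⟨l, hl, hl'⟩ := ih _ (by omega) h1 rfl
      refine ⟨l ++ [i], ?_, ?_⟩
      · intro x hx
        rcases List.mem_append.1 hx with hx | hx
        · exact hl x hx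
        · rw [List.mem_singleton.1 hx]; exact hi
      · simp [hl', mul_assoc, coxeterGen_mul_self]
    by_cases h0 : 1 ≤ n ∧ w 1 < 0
    · exact step 0 h0.1 (weight_lt_mul_zero hw h0.1 h0.2)
    by_cases h1 : ∃ t : ℕ, 1 ≤ t ∧ t < n ∧ w (t + 1) < w t
    · obtain ⟨t, ht, htn, h⟩ := h1
      exact step t htn (weight_lt_mul ht htn h)
    push Not at h0 h1
    refine ⟨[], by simp, ?_⟩
    rw [eq_one_of_increasing hw]
    · simp
    · intro hn
      refine lt_of_le_of_ne (h0 hn) fun h => ?_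
      have hz : w 0 = 0 := by
        have := hw.1 0
        simp only [neg_zero] at this
        omega
      have := w.injective (hz.trans h)
      omega
    · intro t ht htn
      refine lt_of_le_of_ne (h1 t ht htn) fun h => ?_
      have := w.injective h
      omega

theorem mem_descentSet_of_lt {n t : ℕ} {w : Equiv.Perm ℤ} (hw : w ∈ hyperoctahedral n)
    (ht : 1 ≤ t) (htn : t < n) (h : w (t + 1) < w t) : t ∈ descentSet n w := by
  refine ⟨htn, ?_⟩
  -- A word for `w` must exist for `coxeterLength` to be an attained minimum and not the default
  -- `sInf ∅ = 0`.
  obtain ⟨l₀, h₀, h₀'⟩ := exists_word hw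
  obtain ⟨l, hl, hlen, hprod⟩ := Nat.sInf_mem
    (s := {m | ∃ l : List ℕ, (∀ i ∈ l, i < n) ∧ l.length = m ∧ (l.map coxeterGen).prod = w})
    ⟨_, l₀, h₀, rfl, h₀'⟩
  obtain ⟨l', hl', hlen', hprod'⟩ := exists_shorter_word (t := t) (by omega) l hl (by rwa [hprod])
  have h1 : coxeterLength n (w * coxeterGen t) ≤ l'.length :=
    Nat.sInf_le ⟨l', hl', rfl, by rw [hprod', hprod]⟩
  have h2 : l.length = coxeterLength n w := hlen
  omega

/-! ### Row patterns without swaps -/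

theorem exists_first_failure_above {Q : ℕ → Prop} {r n : ℕ} (hrn : r < n) (hn : ¬ Q n) :
    ∃ u, r < u ∧ u ≤ n ∧ ¬ Q u ∧ ∀ x, r < x → x < u → Q x := by
  classical
  have hex : ∃ u, r < u ∧ ¬ Q u := ⟨n, hrn, hn⟩
  refine ⟨Nat.find hex, (Nat.find_spec hex).1, Nat.find_min' hex ⟨hrn, hn⟩,
    (Nat.find_spec hex).2, fun x hx hxu => ?_⟩
  by_contra h
  exact Nat.find_min hex hxu ⟨hx, h⟩

theorem exists_first_failure_below {Q : ℕ → Prop} {v r : ℕ} (hvr : v < r) (hv : ¬ Q v) :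
    ∃ u, v ≤ u ∧ u < r ∧ ¬ Q u ∧ ∀ x, u < x → x < r → Q x := by
  induction r with
  | zero => omega
  | succ r ih =>
    by_cases hr : Q r
    · have hvr' : v ≠ r := by rintro rfl; exact hv hr
      obtain ⟨u, h1, h2, h3, h4⟩ := ih (by omega)
      refine ⟨u, h1, by omega, h3, fun x hx hxr => ?_⟩
      rcases eq_or_ne x r with rfl | hne
      · exact hr
      · exact h4 x hx (by omega)
    · exact ⟨r, by omega, by omega, hr, fun x hx hxr => by omega⟩

/-- `R` holds on the rows that are right of a fixed column, `P` on those of sign `+1` among them,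
and `f` sends such a row to the row that occupies the other column of the same pair of columns. The
fields `first`, `left` and `gap` express the absence of swaps. -/
structure SwapFreePattern (n : ℕ) (R P : ℕ → Prop) (f : ℕ → ℕ) : Prop where
  right_of_pos : ∀ r, P r → R r
  top : ¬ R n
  first : ∀ s, 1 ≤ s → s ≤ n → ¬ R s → (∀ u, 1 ≤ u → u < s → R u) → s % 2 = 1
  left : ∀ a b, 1 ≤ a → a < b → b ≤ n → ¬ R a → ¬ R b → (∀ u, a < u → u < b → R u) →
    a % 2 ≠ b % 2
  gap : ∀ a b, 1 ≤ a → a < b → b ≤ n → ¬ P a → ¬ P b → (∀ u, a < u → u < b → P u) →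
    a % 2 ≠ b % 2
  partner_pos : ∀ r, 1 ≤ r → r ≤ n → P r → r % 2 ≠ n % 2 →
    P (f r) ∧ r < f r ∧ f r ≤ n ∧ f r % 2 = n % 2
  partner_neg : ∀ r, 1 ≤ r → r ≤ n → R r → ¬ P r → r % 2 = n % 2 →
    R (f r) ∧ ¬ P (f r) ∧ r < f r ∧ f r ≤ n ∧ f r % 2 ≠ n % 2
  partner_inj : ∀ r s, 1 ≤ r → r ≤ n → 1 ≤ s → s ≤ n → R r → R s → f r = f s → r = s

namespace SwapFreePattern

variable {n : ℕ} {R P : ℕ → Prop} {f : ℕ → ℕ}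

theorem not_pos_top (h : SwapFreePattern n R P f) : ¬ P n := fun hp => h.top (h.right_of_pos _ hp)

/-- If row `y - 1` were not positive, the parity condition would make the positive run starting at
`y` end at a row `u - 1 ≢ n`, whose partner `u` would again be positive. The bound `r` lets this run
inside the downward induction of `partner_pos_eq`. -/
theorem pos_pred_aux (h : SwapFreePattern n R P f) {r y : ℕ} (hry : r < y) (hyn : y ≤ n)
    (hr : ∀ s, r < s → s ≤ n → P s → s % 2 ≠ n % 2 → f s = s + 1)
    (hy1 : 1 < y) (hy : P y) (hyp : y % 2 = n % 2) : P (y - 1) := by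
  by_contra hc
  have hyn' : y ≠ n := by rintro rfl; exact h.not_pos_top hy
  obtain ⟨u, h1, h2, h3, h4⟩ := exists_first_failure_above (Q := P) (r := y) (by omega)
    h.not_pos_top
  have h5 := h.gap (y - 1) u (by omega) (by omega) h2 hc h3 fun x hx hxu => by
    rcases eq_or_ne x y with rfl | hne
    · exact hy
    · exact h4 x (by omega) hxu
  have h6 : P (u - 1) := h4 _ (by omega) (by omega)
  have h7 := h.partner_pos (u - 1) (by omega) (by omega) h6 (by omega)
  rw [hr (u - 1) (by omega) (by omega) h6 (by omega), Nat.sub_add_cancel (by omega)] at h7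
  exact h3 h7.1

/-- Were the partner higher than `r + 1`, the row just below it would be positive and, by induction,
have the same partner, against injectivity. -/
theorem partner_pos_eq (h : SwapFreePattern n R P f) {r : ℕ} (hr1 : 1 ≤ r) (hrn : r ≤ n)
    (hr : P r) (hrp : r % 2 ≠ n % 2) : f r = r + 1 := by
  induction hm : n - r using Nat.strong_induction_on generalizing r with
  | _ m ih =>
    obtain ⟨h1, h2, h3, h4⟩ := h.partner_pos r hr1 hrn hr hrp
    by_contra hc
    have h5 : P (f r - 1) := h.pos_pred_aux (r := r) h2 h3
      (fun s hs hsn hsP hsp => ih (n - s) (by omega) (by omega) hsn hsP hsp rfl)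
      (by omega) h1 h4
    have h6 := ih (n - (f r - 1)) (by omega) (r := f r - 1) (by omega) (by omega) h5 (by omega) rfl
    have h7 := h.partner_inj (f r - 1) r (by omega) (by omega) hr1 hrn (h.right_of_pos _ h5)
      (h.right_of_pos _ hr) (by omega)
    omega

theorem pos_succ (h : SwapFreePattern n R P f) {r : ℕ} (hr1 : 1 ≤ r) (hrn : r ≤ n)
    (hr : P r) (hrp : r % 2 ≠ n % 2) : P (r + 1) := by
  rw [← h.partner_pos_eq hr1 hrn hr hrp]
  exact (h.partner_pos r hr1 hrn hr hrp).1

theorem pos_pred (h : SwapFreePattern n R P f) {y : ℕ} (hyn : y ≤ n)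
    (hy1 : 1 < y) (hy : P y) (hyp : y % 2 = n % 2) : P (y - 1) :=
  h.pos_pred_aux (r := 0) (by omega) hyn
    (fun _ hs hsn hsP hsp => h.partner_pos_eq hs hsn hsP hsp) hy1 hy hyp

/-- Both claims are needed together in one downward induction: the second, applied to the partner of
`r`, supplies the non-right row that contradicts `left` in the proof of the first. -/
theorem neg_aux (h : SwapFreePattern n R P f) {r : ℕ} (hr1 : 1 ≤ r) (hrn : r ≤ n)
    (hr : R r) (hrP : ¬ P r) :
    (r % 2 = n % 2 → ∀ u, r < u → u < f r → P u) ∧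
      ∃ y, r < y ∧ y ≤ n ∧ ¬ R y ∧ y % 2 = n % 2 ∧ ∀ u, r < u → u < y → R u := by
  induction hm : n - r using Nat.strong_induction_on generalizing r with
  | _ m ih =>
    have hne : r ≠ n := by rintro rfl; exact h.top hr
    obtain ⟨u, h1, h2, h3, h4⟩ := exists_first_failure_above (Q := P) (r := r) (by omega)
      h.not_pos_top
    have h5 := h.gap r u hr1 h1 h2 hrP h3 h4
    have extend : R u → ∃ y, r < y ∧ y ≤ n ∧ ¬ R y ∧ y % 2 = n % 2 ∧
        ∀ u, r < u → u < y → R u := by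
      intro hu
      obtain ⟨-, y, i1, i2, i3, i4, i5⟩ :=
        ih (n - u) (by omega) (r := u) (by omega) h2 hu h3 rfl
      refine ⟨y, by omega, i2, i3, i4, fun x hx hxy => ?_⟩
      rcases lt_trichotomy x u with hxu | rfl | hxu
      · exact h.right_of_pos _ (h4 x hx hxu)
      · exact hu
      · exact i5 x hxu hxy
    by_cases hpar : r % 2 = n % 2
    · obtain ⟨j1, j2, j3, j4, j5⟩ := h.partner_neg r hr1 hrn hr hrP hpar
      -- Otherwise let `v` be the last non-positive row below `f r`; it is `≡ n`. If `v` is right,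
      -- its partner must also be `f r`. If not, `v` and the first non-right row above `f r` bound a
      -- run of right rows and have equal parity.
      have hu : u = f r := by
        by_contra hc
        have hlt : u < f r := by
          by_contra hge
          exact j2 (h4 _ j3 (by omega))
        obtain ⟨v, k1, k2, k3, k4⟩ := exists_first_failure_below (Q := P) hlt h3
        have k5 := h.gap v (f r) (by omega) k2 j4 k3 j2 k4
        by_cases hv : R v
        · have i1 := (ih (n - v) (by omega) (r := v) (by omega) (by omega) hv k3 rfl).1 (by omega)
          obtain ⟨l1, l2, l3, l4, l5⟩ := h.partner_neg v (by omega) (by omega) hv k3 (by omega)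
          have l6 : f v = f r := by
            rcases lt_trichotomy (f v) (f r) with hlt | heq | hgt
            · exact absurd (k4 _ l3 hlt) l2
            · exact heq
            · exact absurd (i1 _ k2 hgt) j2
          have := h.partner_inj v r (by omega) (by omega) hr1 hrn hv hr l6
          omega
        · obtain ⟨-, y, i1, i2, i3, i4, i5⟩ :=
            ih (n - f r) (by omega) (r := f r) (by omega) j4 j1 j2 rfl
          refine h.left v y (by omega) (by omega) i2 hv i3 (fun x hx hxy => ?_) (by omega)
          rcases lt_trichotomy x (f r) with hxu | rfl | hxu
          · exact h.right_of_pos _ (k4 x hx hxu)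
          · exact j1
          · exact i5 x hxu hxy
      refine ⟨fun _ => hu ▸ h4, extend (hu ▸ j1)⟩
    · refine ⟨fun h => absurd h hpar, ?_⟩
      by_cases hu : R u
      · exact extend hu
      · exact ⟨u, h1, h2, hu, by omega, fun x hx hxu => h.right_of_pos _ (h4 x hx hxu)⟩

theorem pos_between_partner (h : SwapFreePattern n R P f) {r : ℕ} (hr1 : 1 ≤ r) (hrn : r ≤ n)
    (hr : R r) (hrP : ¬ P r) (hpar : r % 2 = n % 2) {u : ℕ} (hu : r < u) (hu' : u < f r) : P u :=
  (h.neg_aux hr1 hrn hr hrP).1 hpar u hu hu'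

/-- The first row above a row of sign `-1` that is not right has the parity of `n`. -/
theorem parity_left_above_neg (h : SwapFreePattern n R P f) {r y : ℕ} (hr1 : 1 ≤ r)
    (hr : R r) (hrP : ¬ P r) (hry : r < y) (hyn : y ≤ n) (hy : ¬ R y)
    (hb : ∀ u, r < u → u < y → R u) : y % 2 = n % 2 := by
  obtain ⟨-, z, i1, i2, i3, i4, i5⟩ := h.neg_aux hr1 (by omega) hr hrP
  rcases lt_trichotomy y z with hlt | rfl | hlt
  · exact absurd (i5 y hry hlt) hy
  · exact i4
  · exact absurd (hb z i1 hlt) i3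

/-- This concerns the negative entry of a `(-1, 1)` pair: the nearest non-positive row below it
would either have it as partner or violate `left`. -/
theorem pos_below_of_not_partner (h : SwapFreePattern n R P f) {x : ℕ} (hxn : x ≤ n) (hx : R x)
    (hxP : ¬ P x) (hpar : x % 2 ≠ n % 2)
    (hf : ∀ v, 1 ≤ v → v ≤ n → R v → ¬ P v → v % 2 = n % 2 → f v ≠ x) {s : ℕ} (hs : 1 ≤ s)
    (hsx : s < x) : P s := by
  by_contra hc
  obtain ⟨v, k1, k2, k3, k4⟩ := exists_first_failure_below (Q := P) hsx hc
  have k5 := h.gap v x (by omega) k2 hxn k3 hxP k4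
  by_cases hv : R v
  · have hvA : v % 2 = n % 2 := by omega
    obtain ⟨l1, l2, l3, l4, l5⟩ := h.partner_neg v (by omega) (by omega) hv k3 hvA
    rcases lt_trichotomy (f v) x with hlt | heq | hgt
    · exact l2 (k4 _ l3 hlt)
    · exact hf v (by omega) (by omega) hv k3 hvA heq
    · exact hxP (h.pos_between_partner (by omega) (by omega) hv k3 hvA k2 hgt)
  · obtain ⟨-, y, i1, i2, i3, i4, i5⟩ := h.neg_aux (by omega) hxn hx hxP
    refine h.left v y (by omega) (by omega) i2 hv i3 (fun z hz hzy => ?_) (by omega)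
    rcases lt_trichotomy z x with hxu | rfl | hxu
    · exact h.right_of_pos _ (k4 z hz hxu)
    · exact hx
    · exact i5 z hxu hzy

theorem eq_one_of_not_partner (h : SwapFreePattern n R P f) {y : ℕ} (hy1 : 1 ≤ y) (hyn : y ≤ n)
    (hy : P y) (hpar : y % 2 = n % 2)
    (hf : ∀ v, 1 ≤ v → v ≤ n → P v → v % 2 ≠ n % 2 → f v ≠ y) : y = 1 := by
  by_contra hc
  have h1 := h.pos_pred hyn (by omega) hy hpar
  have h2 := h.partner_pos_eq (by omega) (by omega) h1 (by omega)
  exact hf (y - 1) (by omega) (by omega) h1 (by omega) (by omega)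

/-- A block containing a row of sign `-1` starts at a row with the parity of `n`. -/
theorem parity_block_bottom (h : SwapFreePattern n R P f) {r s x : ℕ} (hb : IsMaximalRun n R r s)
    (hrx : r ≤ x) (hxs : x ≤ s) (hxP : ¬ P x) : r % 2 = n % 2 := by
  obtain ⟨b1, b2, b3, b4, b5, b6⟩ := hb
  have hsn : s ≠ n := by rintro rfl; exact h.top (b4 _ b2 le_rfl)
  have hx : R x := b4 x hrx hxs
  have h1 := h.parity_left_above_neg (y := s + 1) (by omega) hx hxP (by omega) (by omega) (b5 hsn)
    fun u hu hu' => b4 u (by omega) (by omega)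
  rcases eq_or_ne r 1 with rfl | hr
  · have := h.first (s + 1) (by omega) (by omega) (b5 hsn) fun u hu hu' => b4 u hu (by omega)
    omega
  · have := h.left (r - 1) (s + 1) (by omega) (by omega) (by omega) (b6 hr) (b5 hsn)
      fun u hu hu' => b4 u (by omega) (by omega)
    omega

theorem parity_block_top (h : SwapFreePattern n R P f) {r s x : ℕ} (hb : IsMaximalRun n R r s)
    (hrx : r ≤ x) (hxs : x ≤ s) (hxP : ¬ P x) : s % 2 ≠ n % 2 := by
  obtain ⟨b1, b2, b3, b4, b5, b6⟩ := hb
  have hsn : s ≠ n := by rintro rfl; exact h.top (b4 _ b2 le_rfl)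
  have h1 := h.parity_left_above_neg (y := s + 1) (by omega) (b4 x hrx hxs) hxP (by omega)
    (by omega) (b5 hsn) fun u hu hu' => b4 u (by omega) (by omega)
  omega

theorem odd_negBlock_iff (h : SwapFreePattern n R P f) {p q r s : ℕ} (hb : IsMaximalRun n R r s)
    (hN : IsMaximalRun n (fun t => R t ∧ ¬ P t) p q) (hrp : r ≤ p) (hqs : q ≤ s)
    (hne : (p, q) ≠ (r, s)) : p % 2 = q % 2 ↔ p = r ∨ q = s := by
  have hbot := h.parity_block_bottom hb hrp (hN.2.1.trans hqs) (hN.2.2.2.1 p le_rfl hN.2.1).2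
  have htop := h.parity_block_top hb hrp (hN.2.1.trans hqs) (hN.2.2.2.1 p le_rfl hN.2.1).2
  obtain ⟨b1, b2, b3, b4, b5, b6⟩ := hb
  obtain ⟨c1, c2, c3, c4, c5, c6⟩ := hN
  have hp : p ≠ r → p % 2 ≠ n % 2 := by
    intro hpr hpar
    have h1 : P (p - 1) := by
      by_contra hc
      exact c6 (by omega) ⟨b4 _ (by omega) (by omega), hc⟩
    have h2 := h.pos_succ (by omega) (by omega) h1 (by omega)
    rw [Nat.sub_add_cancel (by omega)] at h2
    exact (c4 p le_rfl c2).2 h2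
  have hq : q ≠ s → q % 2 = n % 2 := by
    intro hqs'
    by_contra hpar
    have h1 : P (q + 1) := by
      by_contra hc
      exact c5 (by omega) ⟨b4 _ (by omega) (by omega), hc⟩
    exact (c4 q c2 le_rfl).2 (h.pos_pred (by omega) (by omega) h1 (by omega))
  have hne' : ¬ (p = r ∧ q = s) := by simpa using hne
  by_cases h1 : p = r <;> by_cases h2 : q = s
  · exact absurd ⟨h1, h2⟩ hne'
  · subst h1; have := hq h2; simp; omega
  · subst h2; have := hp h1; simp; omega
  · have := hp h1; have := hq h2; simp [h1, h2]; omega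

/-- If the run stopped before `s`, the block would contain a negative row, so `r ≡ n`; evenness then
gives `q ≢ n`, and the domino starting at `q` extends the run. -/
theorem posBlock_eq_of_bottom (h : SwapFreePattern n R P f) {q r s : ℕ}
    (hb : IsMaximalRun n R r s) (hP : IsMaximalRun n P r q) (hodd : r % 2 ≠ q % 2) : q = s := by
  by_contra hc
  have hqs : q ≤ s := by
    by_contra hlt
    have hsn : s ≠ n := by have := hP.2.2.1; omega
    exact hb.2.2.2.2.1 hsn (h.right_of_pos _ (hP.2.2.2.1 _ (by have := hb.2.1; omega) (by omega)))
  obtain ⟨c1, c2, c3, c4, c5, c6⟩ := hP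
  have hsn := hb.2.2.1
  have h1 : ¬ P (q + 1) := c5 (by omega)
  have hbot := h.parity_block_bottom hb (x := q + 1) (by omega) (by omega) h1
  exact h1 (h.pos_succ (by omega) (by omega) (c4 q c2 le_rfl) (by omega))

theorem posBlock_eq_of_top (h : SwapFreePattern n R P f) {p r s : ℕ}
    (hb : IsMaximalRun n R r s) (hP : IsMaximalRun n P p s) (hodd : p % 2 ≠ s % 2) : p = r := by
  by_contra hc
  have hrp : r ≤ p := by
    by_contra hlt
    have := hP.1
    exact hb.2.2.2.2.2 (by omega)
      (h.right_of_pos _ (hP.2.2.2.1 _ (by omega) (by have := hb.2.1; omega)))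
  obtain ⟨c1, c2, c3, c4, c5, c6⟩ := hP
  have hr1 := hb.1
  have h1 : ¬ P (p - 1) := c6 (by omega)
  have htop := h.parity_block_top hb (x := p - 1) (by omega) (by omega) h1
  exact h1 (h.pos_pred (by omega) (by omega) (c4 p le_rfl c2) (by omega))

end SwapFreePattern

/-! ### Chessboard elements with later gaps even -/

/-- The gaps telescope up to `n`. -/
theorem even_sub_of_laterGapsEven {n : ℕ} {I : Finset ℕ} (hI : I ⊆ Finset.range n) {j : ℕ}
    (h : LaterGapsEven n I j) {a : ℕ} (ha : a ∈ I) (hja : j ≤ a) : Even (n - a) := by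
  induction hm : n - a using Nat.strong_induction_on generalizing a with
  | _ m ih =>
    have han := Finset.mem_range.1 (hI ha)
    classical
    have hex : ∃ b, b ∈ insert n I ∧ a < b := ⟨n, by simp, han⟩
    obtain ⟨hb, hab⟩ := Nat.find_spec hex
    have hmin := h a ha _ hb hja hab fun c hc hc' => Nat.find_min hex hc'.2 ⟨hc, hc'.1⟩
    set b := Nat.find hex
    rcases Finset.mem_insert.1 hb with hbn | hbI
    · rw [← hm, ← hbn]
      exact hmin
    · have hbn := Finset.mem_range.1 (hI hbI)
      have h1 := ih (n - b) (by omega) hbI (by omega) rfl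
      have h2 : m = (n - b) + (b - a) := by omega
      rw [h2]
      exact h1.add hmin

/-- The facts about `w` that the characterization of initially uncanceled elements rests on. -/
structure IsPaired (n j : ℕ) (w : Equiv.Perm ℤ) : Prop where
  mem : w ∈ hyperoctahedral n
  parity : ∀ c, 1 ≤ c → c ≤ n → rowOf w c % 2 = c % 2
  one_le : 1 ≤ j
  lt : j < n
  parity_j : j % 2 = n % 2
  apply_j : w j = n
  increasing : ∀ t, j < t → t < n → t % 2 ≠ n % 2 → w t < w (t + 1)

theorem rowOf_bounds {n : ℕ} {w : Equiv.Perm ℤ} (hw : w ∈ hyperoctahedral n) {c : ℕ}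
    (h1 : 1 ≤ c) (hn : c ≤ n) : 1 ≤ rowOf w c ∧ rowOf w c ≤ n := by
  have h2 := abs_apply_le hw (x := c) (by rw [abs_le]; omega)
  have hz : w 0 = 0 := by
    have := hw.1 0
    simp only [neg_zero] at this
    omega
  have h3 : w c ≠ 0 := by
    intro h
    have := w.injective (h.trans hz.symm)
    omega
  rw [abs_le] at h2
  unfold rowOf
  omega

theorem colOf_rowOf {n : ℕ} {w : Equiv.Perm ℤ} (hw : w ∈ hyperoctahedral n) (c : ℕ) :
    colOf w (rowOf w c) = c :=
  (entry_ne_zero_iff_colOf hw _ _).1 ((entry_ne_zero_iff_rowOf w _ _).2 rfl)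

theorem rowOf_colOf {n : ℕ} {w : Equiv.Perm ℤ} (hw : w ∈ hyperoctahedral n) (r : ℕ) :
    rowOf w (colOf w r) = r :=
  (entry_ne_zero_iff_rowOf w _ _).1 ((entry_ne_zero_iff_colOf hw _ _).2 rfl)

theorem colOf_bounds {n : ℕ} {w : Equiv.Perm ℤ} (hw : w ∈ hyperoctahedral n) {r : ℕ}
    (h1 : 1 ≤ r) (hn : r ≤ n) : 1 ≤ colOf w r ∧ colOf w r ≤ n :=
  rowOf_bounds (w := w⁻¹) (inv_mem hw) h1 hn

theorem entry_rowOf_eq_one_iff (w : Equiv.Perm ℤ) (c : ℕ) :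
    entry w (rowOf w c) c = 1 ↔ 0 ≤ w c := by
  unfold entry rowOf
  rcases lt_or_ge (w c) 0 with h | h
  · have h1 : ((w c).natAbs : ℤ) = -w c := by omega
    rw [h1, neg_neg, if_neg (by omega), if_pos rfl]
    omega
  · have h1 : ((w c).natAbs : ℤ) = w c := by omega
    rw [h1, if_pos rfl]
    omega

theorem entry_rowOf_eq_neg_one_iff (w : Equiv.Perm ℤ) (c : ℕ) :
    entry w (rowOf w c) c = -1 ↔ w c < 0 := by
  unfold entry rowOf
  rcases lt_or_ge (w c) 0 with h | h
  · have h1 : ((w c).natAbs : ℤ) = -w c := by omega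
    rw [h1, neg_neg, if_neg (by omega), if_pos rfl]
    omega
  · have h1 : ((w c).natAbs : ℤ) = w c := by omega
    rw [h1, if_pos rfl]
    omega

theorem isPaired_of_mem {n : ℕ} {I : Finset ℕ} (hI : I ⊆ Finset.range n) {j : ℕ} (hj : j ∈ I)
    (hgaps : LaterGapsEven n I j) {w : Equiv.Perm ℤ}
    (hw : w ∈ chessboardQuotientAt n (compl n I) j) : IsPaired n j w := by
  obtain ⟨⟨⟨hB, hc⟩, -, hd⟩, hat⟩ := hw
  have hjn := Finset.mem_range.1 (hI hj)
  have heven : ∀ a ∈ I, j ≤ a → a % 2 = n % 2 := by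
    intro a ha hja
    have h1 := even_sub_of_laterGapsEven hI hgaps ha hja
    have h2 := Finset.mem_range.1 (hI ha)
    rw [Nat.even_iff] at h1
    omega
  have hjp := heven j hj le_rfl
  have hparity : ∀ c, 1 ≤ c → c ≤ n → rowOf w c % 2 = c % 2 := by
    intro c h1 hn
    have h2 := rowOf_bounds hB h1 hn
    have h3 := hc (rowOf w c) c h2.1 h2.2 h1 hn ((entry_ne_zero_iff_rowOf w _ _).2 rfl)
    simp only [Nat.ModEq] at h3
    omega
  have hwj : w j = n := by
    -- The alternative puts row `n` in column `j + 1`, which has the wrong parity.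
    refine hat.resolve_right fun h => ?_
    have h1 := hparity (j + 1) (by omega) (by omega)
    have h2 : rowOf w (j + 1) = n := by
      unfold rowOf
      push_cast
      omega
    omega
  refine ⟨hB, hparity, ?_, hjn, hjp, hwj, fun t hjt htn htp => ?_⟩
  · by_contra hj0
    have hj0 : j = 0 := by omega
    have := hB.1 0
    subst hj0
    simp only [neg_zero, Nat.cast_zero] at this hwj
    omega
  · rcases lt_trichotomy (w t) (w (t + 1)) with h | h | h
    · exact h
    · have := w.injective h
      omega
    -- Descents of `w` lie in the double complement of `I`, hence in `I`, whose elements from `j` on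
    -- are `≡ n`.
    · have h1 := hd (mem_descentSet_of_lt hB (by omega) htn h)
      simp only [compl, Finset.coe_sdiff, Set.mem_sdiff, Finset.mem_coe, Finset.mem_range, htn,
        true_and, not_not] at h1
      exact absurd (heven t (by simpa using h1) hjt.le) htp

/-- The row of the entry in the other column of the pair that contains the entry of row `r`. -/
def pairedRow (n : ℕ) (w : Equiv.Perm ℤ) (r : ℕ) : ℕ :=
  if colOf w r % 2 = n % 2 then rowOf w (colOf w r - 1) else rowOf w (colOf w r + 1)

/-- Row `r` is right of column `j` and has sign `+1`. -/
def IsRightPos (j : ℕ) (w : Equiv.Perm ℤ) (r : ℕ) : Prop :=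
  j < colOf w r ∧ entry w r (colOf w r) = 1

namespace IsPaired

variable {n j : ℕ} {w : Equiv.Perm ℤ}

theorem parity_colOf (h : IsPaired n j w) {r : ℕ} (h1 : 1 ≤ r) (hn : r ≤ n) :
    colOf w r % 2 = r % 2 := by
  have h2 := colOf_bounds h.mem h1 hn
  have h3 := h.parity _ h2.1 h2.2
  rw [rowOf_colOf h.mem] at h3
  exact h3.symm

theorem colOf_top (h : IsPaired n j w) : colOf w n = j := by
  have h1 : rowOf w j = n := by simp [rowOf, h.apply_j]
  rw [← h1, colOf_rowOf h.mem]

theorem rowOf_inj (h : IsPaired n j w) {a b : ℕ} (hab : rowOf w a = rowOf w b) : a = b := by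
  rw [← colOf_rowOf h.mem a, hab, colOf_rowOf h.mem]

theorem entry_eq_one_iff (h : IsPaired n j w) (r : ℕ) :
    entry w r (colOf w r) = 1 ↔ 0 ≤ w (colOf w r) := by
  have := entry_rowOf_eq_one_iff w (colOf w r)
  rwa [rowOf_colOf h.mem] at this

theorem entry_eq_neg_one_iff (h : IsPaired n j w) (r : ℕ) :
    entry w r (colOf w r) = -1 ↔ w (colOf w r) < 0 := by
  have := entry_rowOf_eq_neg_one_iff w (colOf w r)
  rwa [rowOf_colOf h.mem] at this

theorem entry_eq_neg_one_iff_ne (h : IsPaired n j w) (r : ℕ) :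
    entry w r (colOf w r) = -1 ↔ ¬ entry w r (colOf w r) = 1 := by
  rw [h.entry_eq_neg_one_iff, h.entry_eq_one_iff, not_le]

theorem right_neg_iff (h : IsPaired n j w) (r : ℕ) :
    (j < colOf w r ∧ entry w r (colOf w r) = -1) ↔ (j < colOf w r ∧ ¬ IsRightPos j w r) := by
  rw [h.entry_eq_neg_one_iff_ne, IsRightPos]
  tauto

theorem isSignBlock_neg_one_iff (h : IsPaired n j w) (r s : ℕ) :
    IsSignBlock (-1) n j w r s ↔
      IsMaximalRun n (fun t => j < colOf w t ∧ ¬ IsRightPos j w t) r s := by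
  have : (fun t => j < colOf w t ∧ entry w t (colOf w t) = -1) =
      fun t => j < colOf w t ∧ ¬ IsRightPos j w t := funext fun t => propext (h.right_neg_iff t)
  rw [IsSignBlock, this]

theorem pairedRow_rowOf (h : IsPaired n j w) (c : ℕ) :
    pairedRow n w (rowOf w c) = if c % 2 = n % 2 then rowOf w (c - 1) else rowOf w (c + 1) := by
  rw [pairedRow, colOf_rowOf h.mem]

end IsPaired

theorem exists_maximalRun {n : ℕ} {p : ℕ → Prop} {a b : ℕ} (ha : 1 ≤ a) (hab : a ≤ b)
    (hb : b ≤ n) (h : ∀ t, a ≤ t → t ≤ b → p t) :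
    ∃ r s, IsMaximalRun n p r s ∧ r ≤ a ∧ b ≤ s := by
  -- The predicate is cut off outside `[n]`, so that it fails at `n + 1` and at `0`.
  obtain ⟨u, h1, h2, h3, h4⟩ := exists_first_failure_above (Q := fun x => x ≤ n ∧ p x)
    (r := b) (n := n + 1) (by omega) (by simp)
  obtain ⟨v, k1, k2, k3, k4⟩ := exists_first_failure_below (Q := fun x => 1 ≤ x ∧ p x)
    (v := 0) (r := a) (by omega) (by simp)
  refine ⟨v + 1, u - 1, ⟨by omega, by omega, by omega, fun t ht htu => ?_, fun hne hp => ?_,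
    fun hne hp => ?_⟩, by omega, by omega⟩
  · by_cases hta : t < a
    · exact (k4 t (by omega) hta).2
    · by_cases hbt : b < t
      · exact (h4 t hbt (by omega)).2
      · exact h t (by omega) (by omega)
  · rw [Nat.sub_add_cancel (by omega)] at hp
    exact h3 ⟨by omega, hp⟩
  · rw [Nat.add_sub_cancel] at hp
    exact k3 ⟨by omega, hp⟩

/-- Removing the single-plus swaps loses nothing else: they differ from every other kind in shape,
in the position of `b` or `t` relative to `k`, or in the sign at `t`. -/
theorem generalMinusSwaps_eq_empty_iff (n k : ℕ) (w : Equiv.Perm ℤ) :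
    generalMinusSwaps n k w = ∅ ↔
      (∀ t, ¬ IsSignSwap n k w t) ∧ (∀ b t, ¬ IsLeftSwap n k w b t) ∧
        (∀ b t, ¬ IsSingleSwap (-1) n k w b t) ∧ (∀ b t, ¬ IsDoubleSwap (-1) n k w b t) ∧
          ∀ b t, ¬ IsDoubleSwap 1 n k w b t := by
  rw [Set.eq_empty_iff_forall_notMem]
  constructor
  · intro h
    refine ⟨fun t ht => h (.single t) ⟨?_, ?_⟩, fun b t ht => h (.pair b t) ⟨?_, ?_⟩,
      fun b t ht => h (.pair b t) ⟨?_, ?_⟩, fun b t ht => h (.pair b t) ⟨?_, ?_⟩,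
      fun b t ht => h (.pair b t) ⟨?_, ?_⟩⟩
    · exact Or.inl (Or.inl (Or.inl (Or.inl (Or.inl ⟨t, rfl, ht⟩))))
    · rintro ⟨b', t', he, -⟩
      cases he
    · exact Or.inl (Or.inl (Or.inl (Or.inl (Or.inr ⟨b, t, rfl, ht⟩))))
    · rintro ⟨b', t', he, h'⟩
      cases he
      have h1 := ht.2
      have h2 := h'.2.2.2.1
      omega
    · exact Or.inl (Or.inl (Or.inl (Or.inr ⟨b, t, rfl, ht⟩)))
    · rintro ⟨b', t', he, h'⟩
      cases he
      have h1 := ht.2.1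
      have h2 := h'.2.1
      omega
    · exact Or.inl (Or.inl (Or.inr ⟨b, t, rfl, ht⟩))
    · rintro ⟨b', t', he, h'⟩
      cases he
      have h1 := ht.2.2.2.1
      have h2 := h'.2.2.1
      omega
    · exact Or.inr ⟨b, t, rfl, ht⟩
    · rintro ⟨b', t', he, h'⟩
      cases he
      have h1 := ht.2.2.2.1
      have h2 := h'.2.2.1
      omega
  · rintro ⟨h1, h2, h3, h4, h5⟩ x ⟨hx, hx'⟩
    rcases hx with ((((hx | hx) | hx) | hx) | hx) | hx
    · obtain ⟨t, -, ht⟩ := hx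
      exact h1 t ht
    · obtain ⟨b, t, -, ht⟩ := hx
      exact h2 b t ht
    · obtain ⟨b, t, -, ht⟩ := hx
      exact h3 b t ht
    · obtain ⟨b, t, -, ht⟩ := hx
      exact h4 b t ht
    · exact hx' hx
    · obtain ⟨b, t, -, ht⟩ := hx
      exact h5 b t ht

/-! ### ### From swaps to row patterns, and the two implications -/

namespace IsPaired

variable {n j : ℕ} {w : Equiv.Perm ℤ}

theorem isRightPos_rowOf_iff (h : IsPaired n j w) (c : ℕ) :
    IsRightPos j w (rowOf w c) ↔ j < c ∧ 0 ≤ w c := by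
  rw [IsRightPos, h.entry_eq_one_iff, colOf_rowOf h.mem]

theorem isRightPos_iff (h : IsPaired n j w) (r : ℕ) :
    IsRightPos j w r ↔ j < colOf w r ∧ 0 ≤ w (colOf w r) := by
  rw [IsRightPos, h.entry_eq_one_iff]

/-- Rows in `[n]` with a symmetric property satisfied by all ordered pairs of columns. -/
theorem rows_of_cols (h : IsPaired n j w) {S : ℕ → ℕ → Prop} (hsymm : ∀ a b, S a b → S b a)
    (hS : ∀ c d, 1 ≤ c → c < d → d ≤ n → S (rowOf w c) (rowOf w d)) {a b : ℕ}
    (ha : 1 ≤ a) (hab : a < b) (hb : b ≤ n) : S a b := by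
  have h1 := colOf_bounds h.mem ha (by omega)
  have h2 := colOf_bounds h.mem (r := b) (by omega) hb
  rw [← rowOf_colOf h.mem a, ← rowOf_colOf h.mem b]
  rcases lt_trichotomy (colOf w a) (colOf w b) with hlt | heq | hgt
  · exact hS _ _ h1.1 hlt h2.2
  · have := rowOf_colOf h.mem a
    rw [heq, rowOf_colOf h.mem b] at this
    omega
  · exact hsymm _ _ (hS _ _ h2.1 hgt h1.2)

theorem swapFreePattern (h : IsPaired n j w) (hs : generalMinusSwaps n j w = ∅) :
    SwapFreePattern n (fun r => j < colOf w r) (IsRightPos j w) (pairedRow n w) := by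
  obtain ⟨h1, h2, h3, h4, -⟩ := (generalMinusSwaps_eq_empty_iff n j w).1 hs
  refine ⟨fun r hr => hr.1, ?_, ?_, ?_, ?_, ?_, ?_, ?_⟩
  · rw [h.colOf_top]
    exact lt_irrefl j
  · intro s hs1 hsn hsR hb
    by_contra hpar
    have hc := colOf_bounds h.mem hs1 hsn
    have hp := h.parity_colOf hs1 hsn
    refine h1 (colOf w s) ⟨hc.1, hc.2, by simp only [Nat.ModEq]; omega, by omega, ?_⟩
    rw [rowOf_colOf h.mem]
    exact hb
  · intro a b ha hab hbn haR hbR hb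
    refine h.rows_of_cols (S := fun a b => ¬ j < colOf w a → ¬ j < colOf w b →
      (∀ u, min a b < u → u < max a b → j < colOf w u) → a % 2 ≠ b % 2) ?_ ?_ ha hab hbn haR hbR ?_
    · intro a b hab hb ha hbt
      rw [min_comm, max_comm] at hbt
      exact (hab ha hb hbt).symm
    · intro c d hc hcd hdn hcR hdR hbt hpar
      rw [colOf_rowOf h.mem] at hcR hdR
      rw [h.parity c (by omega) (by omega), h.parity d (by omega) (by omega)] at hpar
      exact h2 c d ⟨⟨hc, hcd, hdn, hpar, fun s hs => hbt s hs.1 hs.2⟩, by omega⟩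
    · rwa [min_eq_left hab.le, max_eq_right hab.le]
  · intro a b ha hab hbn haR hbR hb
    refine h.rows_of_cols (S := fun a b => ¬ IsRightPos j w a → ¬ IsRightPos j w b →
      (∀ u, min a b < u → u < max a b → IsRightPos j w u) → a % 2 ≠ b % 2)
      ?_ ?_ ha hab hbn haR hbR ?_
    · intro a b hab hb ha hbt
      rw [min_comm, max_comm] at hbt
      exact (hab ha hb hbt).symm
    · intro c d hc hcd hdn hcR hdR hbt hpar
      rw [h.isRightPos_rowOf_iff] at hcR hdR
      rw [h.parity c (by omega) (by omega), h.parity d (by omega) (by omega)] at hpar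
      have htwo : IsTwoSwap n j w c d := ⟨hc, hcd, hdn, hpar, fun s hs => (hbt s hs.1 hs.2).1⟩
      have hpos : ∀ s, RowBetween w c d s → entry w s (colOf w s) = - -1 := fun s hs =>
        (hbt s hs.1 hs.2).2.trans (by norm_num)
      -- A row fails to be right and positive either by lying weakly left of `j` or by being
      -- negative; the cases give left, single-minus and double-minus swaps.
      by_cases hdj : d ≤ j
      · exact h2 c d ⟨htwo, hdj⟩
      have hd : entry w (rowOf w d) d = -1 := (entry_rowOf_eq_neg_one_iff w d).2 (by omega)
      by_cases hcj : c ≤ j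
      · exact h3 c d ⟨htwo, hd, hcj, by omega, hpos⟩
      · exact h4 c d ⟨htwo, (entry_rowOf_eq_neg_one_iff w c).2 (by omega), hd, by omega, hcd, hpos⟩
    · rwa [min_eq_left hab.le, max_eq_right hab.le]
  · intro r hr1 hrn hr hpar
    rw [h.isRightPos_iff] at hr
    have hc := colOf_bounds h.mem hr1 hrn
    have hp := h.parity_colOf hr1 hrn
    have hrow : (w (colOf w r)).natAbs = r := rowOf_colOf h.mem r
    rw [pairedRow, if_neg (by omega), h.isRightPos_rowOf_iff]
    set c := colOf w r
    have hcn : c ≠ n := by rintro hcn; omega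
    have hinc := h.increasing c hr.1 (by omega) (by omega)
    have hb := rowOf_bounds h.mem (c := c + 1) (by omega) (by omega)
    have hq := h.parity (c + 1) (by omega) (by omega)
    have hdef : rowOf w (c + 1) = (w (c + 1)).natAbs := by simp [rowOf]
    push_cast
    exact ⟨⟨by omega, by omega⟩, by omega, hb.2, by omega⟩
  · intro r hr1 hrn hrR hr hpar
    rw [h.isRightPos_iff] at hr
    have hc := colOf_bounds h.mem hr1 hrn
    have hp := h.parity_colOf hr1 hrn
    have hrow : (w (colOf w r)).natAbs = r := rowOf_colOf h.mem r
    rw [pairedRow, if_pos (by omega), h.isRightPos_rowOf_iff]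
    simp only [colOf_rowOf h.mem]
    obtain ⟨d, hd⟩ : ∃ d, colOf w r = d + 1 := ⟨colOf w r - 1, by omega⟩
    have hjp := h.parity_j
    rw [hd] at hr hc hp hrow hrR ⊢
    have hinc := h.increasing d (by omega) (by omega) (by omega)
    have hb := rowOf_bounds h.mem (c := d) (by omega) (by omega)
    have hq := h.parity d (by omega) (by omega)
    have hdef : rowOf w d = (w d).natAbs := rfl
    push_cast at hr hrow
    rw [Nat.add_sub_cancel]
    exact ⟨by omega, by omega, by omega, hb.2, by omega⟩
  · intro r s hr1 hrn hs1 hsn _ _ heq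
    have hc := colOf_bounds h.mem hr1 hrn
    have hd := colOf_bounds h.mem hs1 hsn
    rw [← rowOf_colOf h.mem r, ← rowOf_colOf h.mem s]
    congr 1
    unfold pairedRow at heq
    split_ifs at heq <;> have := h.rowOf_inj heq <;> omega

theorem initiallyUncanceled (h : IsPaired n j w) (hs : generalMinusSwaps n j w = ∅) :
    InitiallyUncanceled n j w := by
  have hp := h.swapFreePattern hs
  have hj1 := h.one_le
  have hjn := h.lt
  have hjp := h.parity_j
  have hpos : ∀ r, IsRightPos j w r → entry w r (colOf w r) = 1 ∧ j < colOf w r :=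
    fun r hr => hr.symm
  have hpair : ∀ ε δ t, IsPair n j w ε δ t →
      1 ≤ rowOf w t ∧ rowOf w t ≤ n ∧ 1 ≤ rowOf w (t + 1) ∧ rowOf w (t + 1) ≤ n ∧
        rowOf w t % 2 ≠ n % 2 ∧ rowOf w (t + 1) % 2 = n % 2 ∧ j < t := by
    rintro ε δ t ⟨ht, -, -, htp, hjt⟩
    have h1 := rowOf_bounds h.mem (c := t) (by omega) (by omega)
    have h2 := rowOf_bounds h.mem (c := t + 1) (by omega) (by omega)
    have h3 := h.parity t (by omega) (by omega)
    have h4 := h.parity (t + 1) (by omega) (by omega)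
    simp only [Nat.ModEq] at htp
    exact ⟨h1.1, h1.2, h2.1, h2.2, by omega, by omega, hjt⟩
  have hone : ∀ t, IsPair n j w (-1) 1 t → rowOf w (t + 1) = 1 := by
    intro t ht
    obtain ⟨h1, h2, h3, h4, h5, h6, h7⟩ := hpair _ _ t ht
    obtain ⟨-, hε, hδ, -, -⟩ := ht
    rw [entry_rowOf_eq_neg_one_iff] at hε
    rw [entry_rowOf_eq_one_iff] at hδ
    -- Column `t + 1` is coupled with column `t`, whose entry is negative.
    refine hp.eq_one_of_not_partner h3 h4 ?_ h6 ?_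
    · rw [h.isRightPos_rowOf_iff]
      exact ⟨by omega, hδ⟩
    · intro v hv1 hvn hv hvp heq
      rw [pairedRow, if_neg (by rw [h.parity_colOf hv1 hvn]; exact hvp)] at heq
      have h8 : colOf w v = t := by
        have := h.rowOf_inj heq
        omega
      rw [h.isRightPos_iff, h8] at hv
      omega
  refine ⟨?_, ?_, ?_, ⟨?_, ?_⟩, ?_, ?_, ?_⟩
  · by_contra hc
    rw [not_or, h.entry_eq_neg_one_iff_ne, not_not] at hc
    have h1 : colOf w (n - 1) ≠ j := by
      intro h1
      have h2 := rowOf_colOf h.mem (n - 1)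
      rw [h1, ← h.colOf_top, rowOf_colOf h.mem] at h2
      omega
    have h2 := hp.pos_succ (r := n - 1) (by omega) (by omega) ⟨by omega, hc.2⟩ (by omega)
    rw [Nat.sub_add_cancel (by omega)] at h2
    exact hp.not_pos_top h2
  · rintro r s ⟨b1, b2, b3, b4, b5, b6⟩ hodd
    simp only [OddRows, Nat.ModEq] at hodd
    have hsn : s ≠ n := by rintro rfl; exact hp.top (b4 _ b2 le_rfl)
    rcases eq_or_ne r 1 with rfl | hr
    · have := hp.first (s + 1) (by omega) (by omega) (b5 hsn) fun u hu hu' => b4 u hu (by omega)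
      omega
    · have := hp.left (r - 1) (s + 1) (by omega) (by omega) (by omega) (b6 hr) (b5 hsn)
        fun u hu hu' => b4 u (by omega) (by omega)
      omega
  · intro t ht1 htn hte htj
    obtain ⟨p, q, hrun, hpt, htq⟩ := exists_maximalRun (p := IsRightPos j w) ht1 le_rfl htn
      fun x hx hx' => by rw [show x = t by omega]; exact ⟨htj, hte⟩
    have hrun' := hrun
    obtain ⟨c1, c2, c3, c4, c5, c6⟩ := hrun
    by_cases hp1 : p = 1
    · exact Or.inr fun k hk hkt => c4 k (by omega) (by omega)
    · refine Or.inl ⟨p, q, hrun', fun hodd => ?_, hpt, htq⟩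
      simp only [OddRows, Nat.ModEq] at hodd
      have hqn : q ≠ n := by rintro rfl; exact hp.not_pos_top (c4 _ c2 le_rfl)
      have := hp.gap (p - 1) (q + 1) (by omega) (by omega) (by omega) (c6 hp1) (c5 hqn)
        fun u hu hu' => c4 u (by omega) (by omega)
      omega
  · intro hn t ht
    have h1 := hone t ht
    have h2 := hpair _ _ t ht
    rw [Nat.even_iff] at hn
    omega
  · intro hn
    refine ⟨fun t t' ht ht' => ?_, fun t ht => ⟨hone t ht, fun s hs hst => hpos s ?_⟩⟩
    · have := h.rowOf_inj ((hone t ht).trans (hone t' ht').symm)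
      omega
    · obtain ⟨h1, h2, h3, h4, h5, h6, h7⟩ := hpair _ _ t ht
      obtain ⟨-, hε, hδ, -, -⟩ := ht
      rw [entry_rowOf_eq_neg_one_iff] at hε
      rw [entry_rowOf_eq_one_iff] at hδ
      refine hp.pos_below_of_not_partner h2 ?_ ?_ h5 ?_ hs hst
      · rwa [colOf_rowOf h.mem]
      · rw [h.isRightPos_rowOf_iff]
        omega
      · intro v hv1 hvn hvR hv hvp heq
        rw [pairedRow, if_pos (by rw [h.parity_colOf hv1 hvn]; exact hvp)] at heq
        have h8 : colOf w v = t + 1 := by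
          have := h.rowOf_inj heq
          omega
        rw [h.isRightPos_iff, h8] at hv
        omega
  · intro t ht r hr
    obtain ⟨h1, h2, h3, h4, h5, h6, h7⟩ := hpair _ _ t ht
    obtain ⟨-, -, hδ, htp, -⟩ := ht
    rw [entry_rowOf_eq_neg_one_iff] at hδ
    have hR : j < colOf w (rowOf w (t + 1)) := by
      rw [colOf_rowOf h.mem]
      omega
    have hP : ¬ IsRightPos j w (rowOf w (t + 1)) := by
      rw [h.isRightPos_rowOf_iff]
      omega
    have hf : pairedRow n w (rowOf w (t + 1)) = rowOf w t := by
      simp only [Nat.ModEq] at htp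
      rw [h.pairedRow_rowOf, if_pos (by omega), Nat.add_sub_cancel]
    -- Within the couple the larger row sits in column `t`, since both entries are negative and
    -- increase.
    have hlt := (hp.partner_neg _ h3 h4 hR hP h6).2.2.1
    rw [hf] at hlt
    obtain ⟨hr1, hr2⟩ := hr
    rw [min_eq_right hlt.le] at hr1
    rw [max_eq_left hlt.le] at hr2
    exact hpos r (hp.pos_between_partner h3 h4 hR hP h6 hr1 (by rwa [hf]))
  · intro p q r s hN hB hrp hqs hne
    exact hp.odd_negBlock_iff hB ((h.isSignBlock_neg_one_iff p q).1 hN) hrp hqs hne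
  · intro r s hB _
    exact ⟨fun q hP hodd => hp.posBlock_eq_of_bottom hB hP hodd,
      fun p hP hodd => hp.posBlock_eq_of_top hB hP hodd⟩

theorem generalMinusSwaps_eq_empty (h : IsPaired n j w) (hu : InitiallyUncanceled n j w) :
    generalMinusSwaps n j w = ∅ := by
  have hrows : ∀ b t, IsTwoSwap n j w b t → 1 ≤ min (rowOf w b) (rowOf w t) ∧
      max (rowOf w b) (rowOf w t) ≤ n ∧
      min (rowOf w b) (rowOf w t) + 1 < max (rowOf w b) (rowOf w t) ∧
      min (rowOf w b) (rowOf w t) % 2 = max (rowOf w b) (rowOf w t) % 2 := by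
    rintro b t ⟨h1, h2, h3, h4, -⟩
    have k1 := rowOf_bounds h.mem (c := b) h1 (by omega)
    have k2 := rowOf_bounds h.mem (c := t) (by omega) h3
    have k3 := h.parity b h1 (by omega)
    have k4 := h.parity t (by omega) h3
    simp only [Nat.ModEq] at h4
    have k5 : rowOf w b ≠ rowOf w t := fun hc => by
      have := h.rowOf_inj hc
      omega
    omega
  have hend : ∀ (p : ℕ → Prop) b t, p (rowOf w b) → p (rowOf w t) →
      p (min (rowOf w b) (rowOf w t)) ∧ p (max (rowOf w b) (rowOf w t)) := by
    intro p b t hb ht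
    rcases le_total (rowOf w b) (rowOf w t) with hle | hle
    · rw [min_eq_left hle, max_eq_right hle]
      exact ⟨hb, ht⟩
    · rw [min_eq_right hle, max_eq_left hle]
      exact ⟨ht, hb⟩
  have hgap : ∀ b t, IsTwoSwap n j w b t → ¬ IsRightPos j w (rowOf w b) →
      ¬ IsRightPos j w (rowOf w t) → (∀ s, RowBetween w b t s → IsRightPos j w s) → False := by
    intro b t htwo hb ht hbt
    obtain ⟨r1, r2, r3, r4⟩ := hrows b t htwo
    obtain ⟨e1, e2⟩ := hend (fun x => ¬ IsRightPos j w x) b t hb ht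
    unfold RowBetween at hbt
    set x := min (rowOf w b) (rowOf w t)
    set y := max (rowOf w b) (rowOf w t)
    have hx := hbt (x + 1) ⟨by omega, r3⟩
    -- The block of ones through row `x + 1` is exactly `x + 1, …, y - 1`, odd because `x ≡ y`; the
    -- exception in property 3 would make row `x` positive.
    rcases hu.property3 (x + 1) (by omega) (by omega) hx.2 hx.1 with
      ⟨r, s, ⟨c1, c2, c3, c4, c5, c6⟩, hodd, hr, hs⟩ | hall
    · have h1 : r = x + 1 := by
        by_contra hc
        exact e1 (c4 x (by omega) (by omega))
      have h2 : s = y - 1 := by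
        by_contra hc
        rcases lt_or_gt_of_ne hc with hlt | hgt
        · exact c5 (by omega) (hbt (s + 1) ⟨by omega, by omega⟩)
        · exact e2 (c4 y (by omega) (by omega))
      simp only [OddRows, Nat.ModEq] at hodd
      omega
    · exact e1 (hall x r1 (by omega))
  rw [generalMinusSwaps_eq_empty_iff]
  refine ⟨?_, ?_, ?_, ?_, ?_⟩
  · rintro t ⟨h1, h2, h3, h4, h5⟩
    have k1 := rowOf_bounds h.mem h1 h2
    have k2 := h.parity t h1 h2
    simp only [Nat.ModEq] at h3
    -- The rows below the even row `i(t)` form an odd block.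
    refine hu.property2 1 (rowOf w t - 1) ⟨le_rfl, by omega, by omega, fun s hs hst =>
      h5 s hs (by omega), fun _ => ?_, fun hne => absurd rfl hne⟩
      (by simp only [OddRows, Nat.ModEq]; omega)
    rw [Nat.sub_add_cancel (by omega)]
    simp only [colOf_rowOf h.mem]
    omega
  · rintro b t ⟨htwo, htj⟩
    obtain ⟨r1, r2, r3, r4⟩ := hrows b t htwo
    obtain ⟨h1, h2, h3, h4, h5⟩ := htwo
    obtain ⟨e1, e2⟩ := hend (fun x => ¬ j < colOf w x) b t
      (by rw [colOf_rowOf h.mem]; omega) (by rw [colOf_rowOf h.mem]; omega)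
    unfold RowBetween at h5
    set x := min (rowOf w b) (rowOf w t)
    set y := max (rowOf w b) (rowOf w t)
    refine hu.property2 (x + 1) (y - 1) ⟨by omega, by omega, by omega, fun s hs hst =>
      h5 s ⟨by omega, by omega⟩, fun _ => ?_, fun _ => ?_⟩
      (by simp only [OddRows, Nat.ModEq]; omega)
    · rwa [Nat.sub_add_cancel (by omega)]
    · rwa [Nat.add_sub_cancel]
  · rintro b t ⟨htwo, ht, hbj, hjt, hbt⟩
    rw [entry_rowOf_eq_neg_one_iff] at ht
    refine hgap b t htwo ?_ ?_ fun s hs => ⟨htwo.2.2.2.2 s hs, (hbt s hs).trans (neg_neg 1)⟩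
    · rw [h.isRightPos_rowOf_iff]
      omega
    · rw [h.isRightPos_rowOf_iff]
      omega
  · rintro b t ⟨htwo, hb, ht, hjb, hlt, hbt⟩
    rw [entry_rowOf_eq_neg_one_iff] at hb ht
    refine hgap b t htwo ?_ ?_ fun s hs => ⟨htwo.2.2.2.2 s hs, (hbt s hs).trans (neg_neg 1)⟩
    · rw [h.isRightPos_rowOf_iff]
      omega
    · rw [h.isRightPos_rowOf_iff]
      omega
  · rintro b t ⟨htwo, hb, ht, hjb, hlt, hbt⟩
    rw [entry_rowOf_eq_one_iff] at hb ht
    obtain ⟨r1, r2, r3, r4⟩ := hrows b t htwo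
    obtain ⟨e1, e2⟩ := hend (IsRightPos j w) b t
      (by rw [h.isRightPos_rowOf_iff]; omega) (by rw [h.isRightPos_rowOf_iff]; omega)
    have h5 := htwo.2.2.2.2
    unfold RowBetween at h5 hbt
    set x := min (rowOf w b) (rowOf w t)
    set y := max (rowOf w b) (rowOf w t)
    obtain ⟨r, s, hB, hr, hs⟩ := exists_maximalRun (n := n) (p := fun u => j < colOf w u)
      (a := x) (b := y) r1 (by omega) r2 fun u hu hu' => by
        rcases eq_or_ne u x with rfl | hux
        · exact e1.1
        · rcases eq_or_ne u y with rfl | huy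
          · exact e2.1
          · exact h5 u ⟨by omega, by omega⟩
    have hN : IsSignBlock (-1) n j w (x + 1) (y - 1) := by
      refine ⟨by omega, by omega, by omega, fun u hu hu' => ?_, fun _ hc => ?_, fun _ hc => ?_⟩
      · exact ⟨h5 u ⟨by omega, by omega⟩, hbt u ⟨by omega, by omega⟩⟩
      · rw [Nat.sub_add_cancel (by omega)] at hc
        exact absurd (e2.2.symm.trans hc.2) (by norm_num)
      · rw [Nat.add_sub_cancel] at hc
        exact absurd (e1.2.symm.trans hc.2) (by norm_num)
    -- This negative run is odd, yet rows `x` and `y` of the same block keep it away from both ends.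
    have hodd := (hu.property6 (x + 1) (y - 1) r s hN hB (by omega) (by omega)
      (fun hc => by have := congrArg Prod.fst hc; simp only at this; omega)).1
      (by simp only [OddRows, Nat.ModEq]; omega)
    omega

end IsPaired

end SignedPerm

theorem mainTheorem4 (n : ℕ) (I : Finset ℕ) (hI : I ⊆ Finset.range n) (j : ℕ) (hj : j ∈ I)
    (hgaps : SignedPerm.LaterGapsEven n I j) (w : Equiv.Perm ℤ)
    (hw : w ∈ SignedPerm.chessboardQuotientAt n (SignedPerm.compl n I) j) :
    SignedPerm.InitiallyUncanceled n j w ↔ SignedPerm.generalMinusSwaps n j w = ∅ :=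
  have h := SignedPerm.isPaired_of_mem hI hj hgaps hw
  ⟨h.generalMinusSwaps_eq_empty, h.initiallyUncanceled⟩
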